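/- Let $\mathbb K\in\{\mathbb R,\mathbb C\}$, let $I_1,\dots,I_N\ge 1$ and $P=I_3\cdots I_N$. For a tensor $\mathcal A\in\mathbb K^{I_1\times I_2\times I_3\times\cdots\times I_N}$ let $\mathcal A^{p}\in\mathbb K^{I_1\times I_2}$, $p=1,\dots,P$, be its frontal slices (one for each choice of the indices $(i_3,\dots,i_N)$), let $\langle\mathcal A,\mathcal B\rangle=\sum_{i_1,\dots,i_N}\mathcal A_{i_1\dots i_N}\overline{\mathcal B_{i_1\dots i_N}}$ and $\|\mathcal A\|_F=\langle\mathcal A,\mathcal A\rangle^{1/2}$. For $k=3,\dots,N$ let $M_k=\alpha_kR_k$ with $\alpha_k>0$ and $R_k\in\mathbb K^{I_k\times I_k}$ unitary (orthogonal if $\mathbb K=\mathbb R$), let $\alpha=\alpha_3\cdots\alpha_N$, and let $\mathcal L(\mathcal A)=\mathcal A\times_3M_3\times_4\cdots\times_NM_N$, where $\times_k$ is the mode-$k$ product, $(\mathcal A\times_kU)_{i_1\dots j\dots i_N}=\sum_{i_k}\mathcal A_{i_1\dots i_k\dots i_N}U_{j,i_k}$. For $\mathcal A$ of size $I_1\times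 I_2\times I_3\times\cdots\times I_N$ and $\mathcal B$ of size $I_2\times l\times I_3\times\cdots\times I_N$ let $\mathcal A*_{\mathcal L}\mathcal B=\mathcal L^{-1}(\mathcal C)$ with $\mathcal C^{p}=\mathcal L(\mathcal A)^{p}\mathcal L(\mathcal B)^{p}$. Define - the average rank $\operatorname{rank}_a(\mathcal A)=\frac1P\sum_{p=1}^P\operatorname{rank}(\mathcal L(\mathcal A)^{p})$; - the tensor spectral norm $\|\mathcal A\|=\sup\{\|\mathcal A*_{\mathcal L}\mathcal V\|_F:\ \mathcal V\in\mathbb K^{I_2\times1\times I_3\times\cdots\times I_N},\ \|\mathcal V\|_F=1\}$; - the tensor nuclear norm $\|\mathcal A\|_*=\sup\{|\langle\mathcal A,\mathcal B\rangle|:\ \|\mathcal B\|\le1\}$. The convex envelope of a function $f$ on a convex set $S$ is the largest function that is convex on $S$ and does not exceed $f$ on $S$. Theorem. On the unit ball $\mathbb S=\{\mathcal A:\|\mathcal A\|\le1\}$ of the tensor spectral norm, the convex envelope of the average rank is the tensor nuclear norm up to the normalization of $\mathcal L$, namely the function $$\mathcal A\longmapsto\frac{\alpha^2}{P}\,\|\mathcal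 A\|_*.$$ In particular the convex envelope of the average rank on $\mathbb S$ is the tensor nuclear norm itself if and only if $\alpha^2=P$ (as for the unnormalized discrete Fourier transforms, where $\alpha_k=\sqrt{I_k}$). -/

import Mathlib

noncomputable section

/-- Tensors of size `a × b × d₀ × ⋯ × d_{n-1}` (order `n + 2`) over `𝕜`. A tensor is given by its
frontal slices (its representative matrices): the entry with row `i`, column `j` and remaining
indices `p` is `A p i j`, and `A p` is the slice at the multi-index `p`. -/
abbrev Tensor (𝕜 : Type*) {n : ℕ} (a b : ℕ) (d : Fin n → ℕ) : Type _ :=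
  ((k : Fin n) → Fin (d k)) → Matrix (Fin a) (Fin b) 𝕜

namespace Tensor

variable {𝕜 : Type*} [RCLike 𝕜] {n : ℕ} {a b c : ℕ} {d : Fin n → ℕ}

/-- The number `P = d₀ ⋯ d_{n-1}` of frontal slices. -/
def numSlices (d : Fin n → ℕ) : ℕ := ∏ k, d k

/-- The mode product of a tensor with a square matrix `U` along the slice mode `k`
(the mode number `k + 3` of the tensor). -/
def modeProd (k : Fin n) (U : Matrix (Fin (d k)) (Fin (d k)) 𝕜) (A : Tensor 𝕜 a b d) :
    Tensor 𝕜 a b d :=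
  fun p => Matrix.of fun i j => ∑ q : Fin (d k), A (Function.update p k q) i j * U (p k) q

/-- The transform `L(A) = A ×₃ M₀ ×₄ M₁ ⋯`, the mode products being taken one after the other. -/
def transform (M : (k : Fin n) → Matrix (Fin (d k)) (Fin (d k)) 𝕜) (A : Tensor 𝕜 a b d) :
    Tensor 𝕜 a b d :=
  (List.finRange n).foldl (fun B k => modeProd k (M k) B) A

/-- The inverse transform: the mode products with the inverse matrices, last mode first
(mode products along different modes commute). -/
def invTransform (M : (k : Fin n) → Matrix (Fin (d k)) (Fin (d k)) 𝕜) (A : Tensor 𝕜 a b d) :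
    Tensor 𝕜 a b d :=
  (List.finRange n).foldr (fun k B => modeProd k (M k)⁻¹ B) A

/-- The tensor-tensor product `L⁻¹(L(A) △ L(B))`, where `△` multiplies slice by slice. -/
def lProd (M : (k : Fin n) → Matrix (Fin (d k)) (Fin (d k)) 𝕜)
    (A : Tensor 𝕜 a b d) (B : Tensor 𝕜 b c d) : Tensor 𝕜 a c d :=
  invTransform M fun p => transform M A p * transform M B p

/-- The (Hermitian) inner product of two tensors, the sum over all entries. -/
def dot (A B : Tensor 𝕜 a b d) : 𝕜 :=
  ∑ p, ∑ i, ∑ j, A p i j * star (B p i j)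

/-- The Frobenius norm. -/
def frobNorm (A : Tensor 𝕜 a b d) : ℝ :=
  √(∑ p, ∑ i, ∑ j, ‖A p i j‖ ^ 2)

/-- The tensor spectral norm: the operator norm of `V ↦ A * V` (tensor-tensor product) on tensors
`V` with one column, for Frobenius norms. -/
def spectralNorm (M : (k : Fin n) → Matrix (Fin (d k)) (Fin (d k)) 𝕜) (A : Tensor 𝕜 a b d) : ℝ :=
  sSup {r : ℝ | ∃ V : Tensor 𝕜 b 1 d, frobNorm V = 1 ∧ r = frobNorm (lProd M A V)}

/-- The tensor nuclear norm: the dual norm of the tensor spectral norm. -/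
def nuclearNorm (M : (k : Fin n) → Matrix (Fin (d k)) (Fin (d k)) 𝕜) (A : Tensor 𝕜 a b d) : ℝ :=
  sSup {r : ℝ | ∃ B : Tensor 𝕜 a b d, spectralNorm M B ≤ 1 ∧ r = ‖dot A B‖}

/-- The average rank: the mean of the ranks of the slices of `L(A)`. -/
def averageRank (M : (k : Fin n) → Matrix (Fin (d k)) (Fin (d k)) 𝕜) (A : Tensor 𝕜 a b d) : ℝ :=
  (∑ p, ((transform M A p).rank : ℝ)) / (numSlices d : ℝ)

/-- The unit ball of the tensor spectral norm. -/
def spectralBall (a b : ℕ) (M : (k : Fin n) → Matrix (Fin (d k)) (Fin (d k)) 𝕜) :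
    Set (Tensor 𝕜 a b d) :=
  {A | spectralNorm M A ≤ 1}

end Tensor

/-- `g` is the convex envelope of `f` on the (convex) set `S`: the largest function that is convex
on `S` and lies below `f` on `S`. -/
def IsConvexEnvelopeOn {E : Type*} [AddCommGroup E] [Module ℝ E] (S : Set E) (f g : E → ℝ) : Prop :=
  ConvexOn ℝ S g ∧ (∀ x ∈ S, g x ≤ f x) ∧
    ∀ h : E → ℝ, ConvexOn ℝ S h → (∀ x ∈ S, h x ≤ f x) → ∀ x ∈ S, h x ≤ g x

end

/-!
Since `Mₖ` is a positive multiple `αₖ` of a unitary matrix, the transform `L` is a bijection which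
multiplies inner products by `α ^ 2`, where `α = ∏ αₖ` (`dot_transform`). Moving to the transformed
side, the tensor-tensor product becomes multiplication of slices, so the spectral ball consists of
the tensors all of whose transformed slices are contractions (`mem_spectralBall_iff`), and
`α ^ 2 * nuclearNorm` is the supremum of inner products with families of contractions. Thus the
claim is the matrix case, for several matrices at once: on contractions, the convex envelope of
the rank is the sum of the singular values.

The inner product of two contractions is at most the rank of the first, as is seen by computing the
trace in a basis of right singular vectors (`Matrix.norm_sum_mul_star_le_rank`). Hence the
normalized nuclear norm lies below the average rank. It is convex, being a supremum of seminorms.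

For the maximality, fix singular value decompositions of the transformed slices of a tensor in the
ball, and let the singular values vary in `[0, 1]`. This gives a linear map from a cube to the ball.
At a vertex of the cube the rank is at most the number of ones, so by convexity every convex
minorant of the average rank is, on the whole cube, at most the normalized sum of the coordinates
(`ConvexOn.le_sum_of_le_card`). The sum of the singular values is in turn the inner product with
the contractions whose coefficients are all one, so it is bounded by the nuclear norm
(`le_mul_nuclearNorm_of_convexOn`).

Two convex envelopes agree on the ball, and the nuclear norm is not identically zero there; this
gives the criterion `α ^ 2 = P`.
-/

namespace Tensor

open scoped Matrix

variable {𝕜 : Type*} [RCLike 𝕜] {n : ℕ} {a b : ℕ} {d : Fin n → ℕ}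

/-! ### Mode products -/

theorem modeProd_apply (k : Fin n) (U : Matrix (Fin (d k)) (Fin (d k)) 𝕜) (A : Tensor 𝕜 a b d)
    (p : (k : Fin n) → Fin (d k)) (i : Fin a) (j : Fin b) :
    modeProd k U A p i j = ∑ q : Fin (d k), A (Function.update p k q) i j * U (p k) q := rfl

theorem modeProd_add (k : Fin n) (U : Matrix (Fin (d k)) (Fin (d k)) 𝕜) (A B : Tensor 𝕜 a b d) :
    modeProd k U (A + B) = modeProd k U A + modeProd k U B := by
  funext p
  ext i j
  simp [modeProd_apply, add_mul, Finset.sum_add_distrib]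

theorem modeProd_smul (k : Fin n) (U : Matrix (Fin (d k)) (Fin (d k)) 𝕜) (t : ℝ)
    (A : Tensor 𝕜 a b d) : modeProd k U (t • A) = t • modeProd k U A := by
  funext p
  ext i j
  simp [modeProd_apply, Finset.smul_sum]

theorem modeProd_one (k : Fin n) (A : Tensor 𝕜 a b d) : modeProd k 1 A = A := by
  funext p
  ext i j
  simp [modeProd_apply, Matrix.one_apply]

theorem modeProd_modeProd (k : Fin n) (U V : Matrix (Fin (d k)) (Fin (d k)) 𝕜)
    (A : Tensor 𝕜 a b d) : modeProd k U (modeProd k V A) = modeProd k (U * V) A := by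
  funext p
  ext i j
  simp only [modeProd_apply, Function.update_idem, Function.update_self, Matrix.mul_apply,
    Finset.sum_mul, Finset.mul_sum]
  rw [Finset.sum_comm]
  refine Finset.sum_congr rfl fun q _ => Finset.sum_congr rfl fun r _ => ?_
  ring

theorem dot_smul_right (t : 𝕜) (A B : Tensor 𝕜 a b d) :
    dot A (fun p => t • B p) = star t * dot A B := by
  simp only [dot, Finset.mul_sum, Matrix.smul_apply, smul_eq_mul, star_mul']
  refine Finset.sum_congr rfl fun p _ => Finset.sum_congr rfl fun i _ =>
    Finset.sum_congr rfl fun j _ => ?_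
  ring

/-- Replacing the `k`-th entry of `p` by `q` while keeping the old entry in place of `q` is an
involution of the pairs `(p, q)`. Hence a mode product can be moved across the inner product. -/
theorem dot_modeProd_left (k : Fin n) (U : Matrix (Fin (d k)) (Fin (d k)) 𝕜)
    (A B : Tensor 𝕜 a b d) : dot (modeProd k U A) B = dot A (modeProd k Uᴴ B) := by
  simp only [dot, modeProd_apply, Finset.sum_mul, star_sum, Finset.mul_sum]
  have key : ∀ F : ((k : Fin n) → Fin (d k)) → Fin (d k) → 𝕜,
      ∑ p, ∑ q, F p q = ∑ p, ∑ q, F (Function.update p k q) (p k) := by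
    intro F
    rw [← Fintype.sum_prod_type', ← Fintype.sum_prod_type']
    let e : ((k : Fin n) → Fin (d k)) × Fin (d k) → ((k : Fin n) → Fin (d k)) × Fin (d k) :=
      fun x => (Function.update x.1 k x.2, x.1 k)
    have he : Function.Involutive e := fun x => by simp [e]
    exact (Equiv.sum_comp he.toPerm (fun x => F x.1 x.2)).symm
  have comm : ∀ G : ((k : Fin n) → Fin (d k)) → Fin (d k) → Fin a → Fin b → 𝕜,
      ∑ p, ∑ i, ∑ j, ∑ q, G p q i j = ∑ p, ∑ q, ∑ i, ∑ j, G p q i j := by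
    intro G
    refine Finset.sum_congr rfl fun p _ => ?_
    rw [Finset.sum_comm (s := (Finset.univ : Finset (Fin (d k))))]
    exact Finset.sum_congr rfl fun i _ => Finset.sum_comm
  rw [comm, comm, key]
  refine Finset.sum_congr rfl fun p _ => Finset.sum_congr rfl fun q _ =>
    Finset.sum_congr rfl fun i _ => Finset.sum_congr rfl fun j _ => ?_
  simp only [Function.update_idem, Function.update_self, Function.update_eq_self, star_mul',
    Matrix.conjTranspose_apply, star_star]
  ring

/-- A mode product with `t` times a unitary matrix multiplies inner products by `t ^ 2`. -/
theorem dot_modeProd_modeProd (k : Fin n) {U : Matrix (Fin (d k)) (Fin (d k)) 𝕜} {t : ℝ}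
    (hU : Uᴴ * U = ((t ^ 2 : ℝ) : 𝕜) • 1) (A B : Tensor 𝕜 a b d) :
    dot (modeProd k U A) (modeProd k U B) = ((t ^ 2 : ℝ) : 𝕜) * dot A B := by
  have h : modeProd k (((t ^ 2 : ℝ) : 𝕜) • (1 : Matrix (Fin (d k)) (Fin (d k)) 𝕜)) B =
      fun p => ((t ^ 2 : ℝ) : 𝕜) • B p := by
    funext p
    ext i j
    simp [modeProd_apply, Matrix.one_apply, mul_comm]
  rw [dot_modeProd_left, modeProd_modeProd, hU, h, dot_smul_right]
  simp

/-! ### The transform -/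

variable {M : (k : Fin n) → Matrix (Fin (d k)) (Fin (d k)) 𝕜} {α : Fin n → ℝ}

theorem transform_add (A B : Tensor 𝕜 a b d) :
    transform M (A + B) = transform M A + transform M B := by
  simp only [transform]
  induction List.finRange n generalizing A B with
  | nil => rfl
  | cons k l ih => simp only [List.foldl_cons, modeProd_add, ih]

theorem transform_smul (t : ℝ) (A : Tensor 𝕜 a b d) :
    transform M (t • A) = t • transform M A := by
  simp only [transform]
  induction List.finRange n generalizing A with
  | nil => rfl
  | cons k l ih => simp only [List.foldl_cons, modeProd_smul, ih]

theorem isUnit_det_of_conjTranspose_mul_self (hα : ∀ k, 0 < α k)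
    (hM : ∀ k, (M k)ᴴ * M k = ((α k ^ 2 : ℝ) : 𝕜) • 1) (k : Fin n) : IsUnit (M k).det := by
  have h : ((α k ^ 2 : ℝ) : 𝕜) ≠ 0 := by
    exact_mod_cast (pow_pos (hα k) 2).ne'
  refine Matrix.isUnit_det_of_left_inverse (B := (((α k ^ 2 : ℝ) : 𝕜))⁻¹ • (M k)ᴴ) ?_
  rw [Matrix.smul_mul, hM, smul_smul, inv_mul_cancel₀ h, one_smul]

/-- The transform as a real-linear equivalence; its inverse is `invTransform`. -/
noncomputable def transformEquiv (a b : ℕ) (M : (k : Fin n) → Matrix (Fin (d k)) (Fin (d k)) 𝕜)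
    (hM : ∀ k, IsUnit (M k).det) : Tensor 𝕜 a b d ≃ₗ[ℝ] Tensor 𝕜 a b d where
  toFun := transform M
  map_add' := transform_add
  map_smul' := transform_smul
  invFun := invTransform M
  left_inv A := by
    simp only [transform, invTransform]
    induction List.finRange n generalizing A with
    | nil => rfl
    | cons k l ih =>
      rw [List.foldl_cons, List.foldr_cons, ih, modeProd_modeProd,
        Matrix.nonsing_inv_mul _ (hM k), modeProd_one]
  right_inv A := by
    simp only [transform, invTransform]
    induction List.finRange n generalizing A with
    | nil => rfl
    | cons k l ih =>
      rw [List.foldl_cons, List.foldr_cons, modeProd_modeProd,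
        Matrix.mul_nonsing_inv _ (hM k), modeProd_one, ih]

theorem invTransform_transform (hM : ∀ k, IsUnit (M k).det) (A : Tensor 𝕜 a b d) :
    invTransform M (transform M A) = A :=
  (transformEquiv a b M hM).left_inv A

theorem transform_invTransform (hM : ∀ k, IsUnit (M k).det) (A : Tensor 𝕜 a b d) :
    transform M (invTransform M A) = A :=
  (transformEquiv a b M hM).right_inv A

theorem dot_transform (hM : ∀ k, (M k)ᴴ * M k = ((α k ^ 2 : ℝ) : 𝕜) • 1)
    (A B : Tensor 𝕜 a b d) :
    dot (transform M A) (transform M B) = (((∏ k, α k) ^ 2 : ℝ) : 𝕜) * dot A B := by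
  rw [Fin.prod_univ_def]
  simp only [transform]
  induction List.finRange n generalizing A B with
  | nil => simp
  | cons k l ih =>
    rw [List.foldl_cons, List.foldl_cons, ih, dot_modeProd_modeProd k (hM k), List.map_cons,
      List.prod_cons]
    push_cast
    ring

theorem dot_self (A : Tensor 𝕜 a b d) : dot A A = ((frobNorm A ^ 2 : ℝ) : 𝕜) := by
  rw [frobNorm, Real.sq_sqrt (by positivity)]
  simp only [dot, RCLike.star_def, RCLike.mul_conj]
  push_cast
  rfl

theorem frobNorm_nonneg (A : Tensor 𝕜 a b d) : 0 ≤ frobNorm A := Real.sqrt_nonneg _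

theorem frobNorm_transform (hα : ∀ k, 0 < α k)
    (hM : ∀ k, (M k)ᴴ * M k = ((α k ^ 2 : ℝ) : 𝕜) • 1) (A : Tensor 𝕜 a b d) :
    frobNorm (transform M A) = (∏ k, α k) * frobNorm A := by
  have h := dot_transform hM A A
  rw [dot_self, dot_self, ← RCLike.ofReal_mul, RCLike.ofReal_inj, ← mul_pow] at h
  exact (sq_eq_sq₀ (frobNorm_nonneg _)
    (mul_nonneg (Finset.prod_nonneg fun k _ => (hα k).le) (frobNorm_nonneg _))).1 h

end Tensor

/-! ### Contractions and singular vectors -/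

namespace Matrix

open scoped Matrix InnerProductSpace ComplexOrder

variable {𝕜 : Type*} [RCLike 𝕜] {m n : Type*} [Fintype n] [DecidableEq n]

/-- The matrix `∑ i, c i • u i * (v i)ᴴ`. -/
noncomputable def ofSingular (u : n → EuclideanSpace 𝕜 m) (v : n → EuclideanSpace 𝕜 n)
    (c : n → ℝ) : Matrix m n 𝕜 :=
  (of fun r i => u i r) * diagonal (fun i => (c i : 𝕜)) * (of fun i s => star (v i s))

theorem ofSingular_add (u : n → EuclideanSpace 𝕜 m) (v : n → EuclideanSpace 𝕜 n) (c e : n → ℝ) :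
    ofSingular u v (c + e) = ofSingular u v c + ofSingular u v e := by
  simp only [ofSingular, Pi.add_apply, RCLike.ofReal_add, ← diagonal_add, Matrix.mul_add,
    Matrix.add_mul]

theorem ofSingular_smul (u : n → EuclideanSpace 𝕜 m) (v : n → EuclideanSpace 𝕜 n) (t : ℝ)
    (c : n → ℝ) : ofSingular u v (t • c) = t • ofSingular u v c := by
  have h : diagonal (fun i => ((t • c) i : 𝕜)) = t • diagonal (fun i => (c i : 𝕜)) := by
    ext i j
    by_cases hij : i = j <;> simp [hij, RCLike.real_smul_eq_coe_mul]
  simp only [ofSingular, h, Matrix.mul_smul, Matrix.smul_mul]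

theorem rank_ofSingular_le (u : n → EuclideanSpace 𝕜 m) (v : n → EuclideanSpace 𝕜 n)
    (c : n → ℝ) : (ofSingular u v c).rank ≤ Fintype.card {i // c i ≠ 0} := by
  refine (rank_mul_le_left _ _).trans ((rank_mul_le_right _ _).trans ?_)
  rw [rank_diagonal]
  exact (Fintype.card_congr (Equiv.subtypeEquivRight fun i => by simp)).le

theorem toEuclideanLin_ofSingular (u : n → EuclideanSpace 𝕜 m)
    (v : OrthonormalBasis n 𝕜 (EuclideanSpace 𝕜 n)) (c : n → ℝ) (x : EuclideanSpace 𝕜 n) :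
    toEuclideanLin (ofSingular u v c) x = ∑ i, ((c i : 𝕜) * ⟪v i, x⟫_𝕜) • u i := by
  ext r
  have h1 : (of fun i s => star (v i s) : Matrix n n 𝕜) *ᵥ x.ofLp = fun i => ⟪v i, x⟫_𝕜 := by
    funext i
    simp [PiLp.inner_apply, mulVec, dotProduct, mul_comm]
  have h2 : diagonal (fun i => (c i : 𝕜)) *ᵥ (fun i => ⟪v i, x⟫_𝕜) =
      fun i => (c i : 𝕜) * ⟪v i, x⟫_𝕜 := funext fun i => mulVec_diagonal _ _ _
  rw [toLpLin_apply, ofSingular, ← mulVec_mulVec, ← mulVec_mulVec, h1, h2]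
  simp [mulVec, dotProduct, mul_comm]

variable [Fintype m]

/-- A matrix whose operator norm for the Euclidean norms is at most one. -/
def IsContraction (X : Matrix m n 𝕜) : Prop :=
  ∀ x : EuclideanSpace 𝕜 n, ‖toEuclideanLin X x‖ ≤ ‖x‖

theorem exists_norm_toEuclideanLin_le (X : Matrix m n 𝕜) :
    ∃ C : ℝ, 0 ≤ C ∧ ∀ x : EuclideanSpace 𝕜 n, ‖toEuclideanLin X x‖ ≤ C * ‖x‖ :=
  ⟨‖LinearMap.toContinuousLinearMap (toEuclideanLin X)‖, norm_nonneg _,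
    fun x => (LinearMap.toContinuousLinearMap (toEuclideanLin X)).le_opNorm x⟩

theorem exists_ne_zero_isContraction [Nonempty m] [Nonempty n] :
    ∃ X : Matrix m n 𝕜, X ≠ 0 ∧ X.IsContraction := by
  obtain ⟨i⟩ := ‹Nonempty m›
  obtain ⟨j⟩ := ‹Nonempty n›
  obtain ⟨C, hC, h⟩ := exists_norm_toEuclideanLin_le (Matrix.of fun _ _ => 1 : Matrix m n 𝕜)
  refine ⟨((C + 1)⁻¹ : ℝ) • Matrix.of fun _ _ => 1, fun h0 => ?_, fun x => ?_⟩
  · have h1 := congrFun (congrFun h0 i) j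
    have h2 : C + 1 ≠ 0 := by positivity
    simp only [smul_apply, of_apply, zero_apply, smul_eq_zero, inv_eq_zero, one_ne_zero,
      or_false] at h1
    exact h2 h1
  · rw [RCLike.real_smul_eq_coe_smul (K := 𝕜), map_smul, LinearMap.smul_apply, norm_smul,
      RCLike.norm_ofReal, abs_of_nonneg (by positivity), inv_mul_le_iff₀ (by positivity)]
    nlinarith [h x, norm_nonneg x]

theorem IsContraction.convex_combination {X Y : Matrix m n 𝕜} (hX : X.IsContraction)
    (hY : Y.IsContraction) {s t : ℝ} (hs : 0 ≤ s) (ht : 0 ≤ t) (hst : s + t = 1) :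
    (s • X + t • Y).IsContraction := by
  intro x
  rw [RCLike.real_smul_eq_coe_smul (K := 𝕜), RCLike.real_smul_eq_coe_smul (K := 𝕜), map_add,
    map_smul, map_smul]
  calc _ ≤ ‖(s : 𝕜) • toEuclideanLin X x‖ + ‖(t : 𝕜) • toEuclideanLin Y x‖ := norm_add_le _ _
    _ = s * ‖toEuclideanLin X x‖ + t * ‖toEuclideanLin Y x‖ := by
      rw [norm_smul, norm_smul, RCLike.norm_ofReal, RCLike.norm_ofReal, abs_of_nonneg hs,
        abs_of_nonneg ht]
    _ ≤ s * ‖x‖ + t * ‖x‖ := by gcongr <;> [exact hX x; exact hY x]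
    _ = ‖x‖ := by rw [← add_mul, hst, one_mul]

/-- The entrywise inner product of two matrices computed in any orthonormal basis: both sides are
the trace of `Yᴴ * X`. -/
theorem sum_mul_star_eq_sum_inner {ι : Type*} [Fintype ι] (X Y : Matrix m n 𝕜)
    (v : OrthonormalBasis ι 𝕜 (EuclideanSpace 𝕜 n)) :
    ∑ i, ∑ j, X i j * star (Y i j) =
      ∑ i, ⟪toEuclideanLin Y (v i), toEuclideanLin X (v i)⟫_𝕜 := by
  let T := LinearMap.adjoint (toEuclideanLin Y) ∘ₗ toEuclideanLin X
  have h1 := LinearMap.trace_eq_sum_inner T v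
  have h2 := LinearMap.trace_eq_sum_inner T (EuclideanSpace.basisFun n 𝕜)
  simp only [T, LinearMap.comp_apply, LinearMap.adjoint_inner_right] at h1 h2
  rw [← h1, h2, Finset.sum_comm]
  refine Finset.sum_congr rfl fun j _ => ?_
  simp [PiLp.inner_apply, toLpLin_apply]

theorem norm_sum_mul_star_le {ι : Type*} [Fintype ι] (X : Matrix m n 𝕜) {Y : Matrix m n 𝕜}
    (hY : Y.IsContraction) (v : OrthonormalBasis ι 𝕜 (EuclideanSpace 𝕜 n)) :
    ‖∑ i, ∑ j, X i j * star (Y i j)‖ ≤ ∑ i, ‖toEuclideanLin X (v i)‖ := by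
  rw [sum_mul_star_eq_sum_inner X Y v]
  refine (norm_sum_le _ _).trans (Finset.sum_le_sum fun i _ => ?_)
  refine (norm_inner_le_norm _ _).trans (mul_le_of_le_one_left (norm_nonneg _) ?_)
  simpa using hY (v i)

/-- Right singular vectors: an orthonormal basis which `X` maps to pairwise orthogonal vectors,
namely an eigenvector basis of `Xᴴ * X`. -/
theorem exists_rightSingularBasis (X : Matrix m n 𝕜) :
    ∃ v : OrthonormalBasis n 𝕜 (EuclideanSpace 𝕜 n),
      (∀ i j, i ≠ j → ⟪toEuclideanLin X (v i), toEuclideanLin X (v j)⟫_𝕜 = 0) ∧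
      Fintype.card {i // toEuclideanLin X (v i) ≠ 0} = X.rank := by
  classical
  have hH := isHermitian_conjTranspose_mul_self X
  have key : ∀ i j, ⟪toEuclideanLin X (hH.eigenvectorBasis i),
      toEuclideanLin X (hH.eigenvectorBasis j)⟫_𝕜 =
      if i = j then (hH.eigenvalues j : 𝕜) else 0 := by
    intro i j
    rw [← LinearMap.adjoint_inner_right, ← toEuclideanLin_conjTranspose_eq_adjoint]
    have h : toEuclideanLin Xᴴ (toEuclideanLin X (hH.eigenvectorBasis j)) =
        (hH.eigenvalues j : 𝕜) • hH.eigenvectorBasis j := by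
      have := hH.mulVec_eigenvectorBasis j
      rw [← mulVec_mulVec] at this
      ext r
      simpa [toLpLin_apply, RCLike.real_smul_eq_coe_mul] using congrFun this r
    rw [h, inner_smul_right, orthonormal_iff_ite.1 hH.eigenvectorBasis.orthonormal i j]
    simp
  refine ⟨hH.eigenvectorBasis, fun i j hij => by rw [key, if_neg hij], ?_⟩
  rw [← rank_conjTranspose_mul_self X, hH.rank_eq_card_non_zero_eigs]
  refine Fintype.card_congr (Equiv.subtypeEquivRight fun i => not_congr ?_)
  rw [← inner_self_eq_zero (𝕜 := 𝕜), key, if_pos rfl, RCLike.ofReal_eq_zero]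

/-- The inner product of two contractions is at most the rank of the first: in a basis of right
singular vectors of `X`, only `X.rank` terms of the trace are nonzero, each of norm at most one. -/
theorem norm_sum_mul_star_le_rank {X Y : Matrix m n 𝕜} (hX : X.IsContraction)
    (hY : Y.IsContraction) : ‖∑ i, ∑ j, X i j * star (Y i j)‖ ≤ X.rank := by
  obtain ⟨v, -, hv⟩ := exists_rightSingularBasis X
  refine (norm_sum_mul_star_le X hY v).trans ?_
  calc ∑ i, ‖toEuclideanLin X (v i)‖
      ≤ ∑ i, if toEuclideanLin X (v i) ≠ 0 then (1 : ℝ) else 0 := by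
        refine Finset.sum_le_sum fun i _ => ?_
        split_ifs with h
        · simpa using hX (v i)
        · simp [not_not.1 h]
    _ = X.rank := by
        rw [← hv, Fintype.card_subtype, Finset.sum_boole]

theorem isContraction_ofSingular {u : n → EuclideanSpace 𝕜 m}
    (v : OrthonormalBasis n 𝕜 (EuclideanSpace 𝕜 n)) {c : n → ℝ}
    (hu : ∀ i j, i ≠ j → ⟪u i, u j⟫_𝕜 = 0) (hu1 : ∀ i, ‖u i‖ ≤ 1)
    (hc : ∀ i, c i ∈ Set.Icc (0 : ℝ) 1) : (ofSingular u v c).IsContraction := by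
  intro x
  refine (sq_le_sq₀ (norm_nonneg _) (norm_nonneg _)).1 ?_
  have h : ∀ w : n → 𝕜, ‖∑ i, w i • u i‖ ^ 2 = ∑ i, ‖w i‖ ^ 2 * ‖u i‖ ^ 2 := by
    intro w
    have : ((‖∑ i, w i • u i‖ ^ 2 : ℝ) : 𝕜) = ((∑ i, ‖w i‖ ^ 2 * ‖u i‖ ^ 2 : ℝ) : 𝕜) := by
      push_cast
      rw [← inner_self_eq_norm_sq_to_K, sum_inner]
      refine Finset.sum_congr rfl fun i _ => ?_
      rw [inner_sum, Finset.sum_eq_single i]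
      · rw [inner_smul_left, inner_smul_right, inner_self_eq_norm_sq_to_K, ← mul_assoc,
          RCLike.conj_mul]
      · intro j _ hj
        rw [inner_smul_left, inner_smul_right, hu i j hj.symm, mul_zero, mul_zero]
      · simp
    exact_mod_cast this
  rw [toEuclideanLin_ofSingular, h, ← v.sum_sq_norm_inner_right x]
  refine Finset.sum_le_sum fun i _ => ?_
  rw [norm_mul, RCLike.norm_ofReal, abs_of_nonneg (hc i).1]
  have h1 : c i * ‖⟪v i, x⟫_𝕜‖ ≤ ‖⟪v i, x⟫_𝕜‖ := mul_le_of_le_one_left (norm_nonneg _) (hc i).2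
  have h2 : ‖u i‖ ^ 2 ≤ 1 := pow_le_one₀ (norm_nonneg _) (hu1 i)
  calc _ ≤ (c i * ‖⟪v i, x⟫_𝕜‖) ^ 2 * 1 := by gcongr
    _ ≤ _ := by
      rw [mul_one]
      exact pow_le_pow_left₀ (mul_nonneg (hc i).1 (norm_nonneg _)) h1 2

/-- Singular value decomposition of a contraction `X`: with the vectors `u i` (orthogonal, of norm
one or zero) and the orthonormal basis `v`, all `ofSingular u v c` with coefficients in `[0, 1]`
are contractions, `X` is the one whose coefficients are the singular values `σ`, and pairing `X`
with the one whose coefficients are all `1` gives the sum of the singular values. -/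
theorem IsContraction.exists_singularValues {X : Matrix m n 𝕜} (hX : X.IsContraction) :
    ∃ (u : n → EuclideanSpace 𝕜 m) (v : n → EuclideanSpace 𝕜 n) (σ : n → ℝ),
      (∀ i, σ i ∈ Set.Icc (0 : ℝ) 1) ∧ ofSingular u v σ = X ∧
      (∀ c : n → ℝ, (∀ i, c i ∈ Set.Icc (0 : ℝ) 1) → (ofSingular u v c).IsContraction) ∧
      ∑ i, ∑ j, X i j * star (ofSingular u v 1 i j) = ((∑ i, σ i : ℝ) : 𝕜) := by
  obtain ⟨v, hv, -⟩ := exists_rightSingularBasis X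
  -- the inverse of `0` is `0`, so that `u i = 0` where the singular value vanishes
  let u : n → EuclideanSpace 𝕜 m := fun i =>
    ((‖toEuclideanLin X (v i)‖⁻¹ : ℝ) : 𝕜) • toEuclideanLin X (v i)
  have act : ∀ c j, toEuclideanLin (ofSingular u v c) (v j) = (c j : 𝕜) • u j := by
    intro c j
    rw [toEuclideanLin_ofSingular, Finset.sum_eq_single j]
    · simp
    · intro i _ hi
      simp [v.inner_eq_zero hi]
    · simp
  refine ⟨u, v, fun i => ‖toEuclideanLin X (v i)‖, fun i => ⟨norm_nonneg _, ?_⟩, ?_, ?_, ?_⟩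
  · simpa using hX (v i)
  · refine toEuclideanLin.injective (v.toBasis.ext fun i => ?_)
    rw [OrthonormalBasis.coe_toBasis, act, smul_smul, ← RCLike.ofReal_mul]
    by_cases h : ‖toEuclideanLin X (v i)‖ = 0
    · rw [norm_eq_zero.1 h, smul_zero]
    · rw [mul_inv_cancel₀ h, RCLike.ofReal_one, one_smul]
  · refine fun c hc => isContraction_ofSingular v (fun i j hij => ?_) (fun i => ?_) hc
    · rw [inner_smul_left, inner_smul_right, hv i j hij, mul_zero, mul_zero]
    · rw [norm_smul, RCLike.norm_ofReal, abs_of_nonneg (by positivity)]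
      exact inv_mul_le_one
  · rw [sum_mul_star_eq_sum_inner _ _ v, RCLike.ofReal_sum]
    refine Finset.sum_congr rfl fun i _ => ?_
    rw [act, Pi.one_apply, RCLike.ofReal_one, one_smul, inner_smul_left,
      inner_self_eq_norm_sq_to_K, RCLike.conj_ofReal, ← RCLike.ofReal_pow, ← RCLike.ofReal_mul,
      RCLike.ofReal_inj]
    by_cases h : ‖toEuclideanLin X (v i)‖ = 0
    · simp [h]
    · field_simp

end Matrix

namespace Tensor

open scoped Matrix
open Matrix (toEuclideanLin IsContraction ofSingular)

variable {𝕜 : Type*} [RCLike 𝕜] {n : ℕ} {a b : ℕ} {d : Fin n → ℕ}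
  {M : (k : Fin n) → Matrix (Fin (d k)) (Fin (d k)) 𝕜} {α : Fin n → ℝ}

/-! ### The spectral ball -/

theorem frobNorm_column (V : Tensor 𝕜 b 1 d) :
    frobNorm V = √(∑ p, ‖WithLp.toLp 2 fun i => V p i 0‖ ^ 2) := by
  simp [frobNorm, EuclideanSpace.norm_sq_eq]

theorem frobNorm_mul_le {A : Tensor 𝕜 a b d} {C : ℝ} (hC : 0 ≤ C)
    (hA : ∀ p x, ‖toEuclideanLin (A p) x‖ ≤ C * ‖x‖) (V : Tensor 𝕜 b 1 d) :
    frobNorm (fun p => A p * V p) ≤ C * frobNorm V := by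
  rw [frobNorm_column, frobNorm_column]
  refine Real.sqrt_le_iff.2 ⟨by positivity, ?_⟩
  rw [mul_pow, Real.sq_sqrt (by positivity), Finset.mul_sum]
  refine Finset.sum_le_sum fun p _ => ?_
  rw [← mul_pow]
  exact pow_le_pow_left₀ (norm_nonneg _) (hA p (WithLp.toLp 2 fun i => V p i 0)) 2

theorem mul_frobNorm_lProd (hα : ∀ k, 0 < α k)
    (hM : ∀ k, (M k)ᴴ * M k = ((α k ^ 2 : ℝ) : 𝕜) • 1) (A : Tensor 𝕜 a b d)
    (V : Tensor 𝕜 b 1 d) :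
    (∏ k, α k) * frobNorm (lProd M A V) =
      frobNorm (fun p => transform M A p * transform M V p) := by
  rw [← frobNorm_transform hα hM, lProd,
    transform_invTransform (isUnit_det_of_conjTranspose_mul_self hα hM)]

theorem frobNorm_lProd_le (hα : ∀ k, 0 < α k)
    (hM : ∀ k, (M k)ᴴ * M k = ((α k ^ 2 : ℝ) : 𝕜) • 1) {A : Tensor 𝕜 a b d} {C : ℝ} (hC : 0 ≤ C)
    (hA : ∀ p x, ‖toEuclideanLin (transform M A p) x‖ ≤ C * ‖x‖) (V : Tensor 𝕜 b 1 d) :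
    frobNorm (lProd M A V) ≤ C * frobNorm V := by
  have hpos : 0 < ∏ k, α k := Finset.prod_pos fun k _ => hα k
  refine le_of_mul_le_mul_left ?_ hpos
  rw [mul_frobNorm_lProd hα hM]
  refine (frobNorm_mul_le hC hA _).trans_eq ?_
  rw [frobNorm_transform hα hM]
  ring

/-- The supremum that defines the spectral norm is finite. -/
theorem bddAbove_frobNorm_lProd (hα : ∀ k, 0 < α k)
    (hM : ∀ k, (M k)ᴴ * M k = ((α k ^ 2 : ℝ) : 𝕜) • 1) (A : Tensor 𝕜 a b d) :
    BddAbove {r : ℝ | ∃ V : Tensor 𝕜 b 1 d, frobNorm V = 1 ∧ r = frobNorm (lProd M A V)} := by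
  choose C hC0 hC using fun p => Matrix.exists_norm_toEuclideanLin_le (transform M A p)
  refine ⟨∑ p, C p, ?_⟩
  rintro r ⟨V, hV, rfl⟩
  have h := frobNorm_lProd_le hα hM (Finset.sum_nonneg fun p _ => hC0 p)
    (fun p x => (hC p x).trans (mul_le_mul_of_nonneg_right
      (Finset.single_le_sum (fun q _ => hC0 q) (Finset.mem_univ p)) (norm_nonneg x))) V
  rwa [hV, mul_one] at h

/-- The transform turns the spectral ball into the product of the balls of contractions. -/
theorem mem_spectralBall_iff (hα : ∀ k, 0 < α k)
    (hM : ∀ k, (M k)ᴴ * M k = ((α k ^ 2 : ℝ) : 𝕜) • 1) {A : Tensor 𝕜 a b d} :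
    A ∈ spectralBall a b M ↔ ∀ p, (transform M A p).IsContraction := by
  have hpos : 0 < ∏ k, α k := Finset.prod_pos fun k _ => hα k
  refine ⟨fun h p x => ?_, fun h => ?_⟩
  · rcases eq_or_ne x 0 with rfl | hx
    · simp
    have hx' : 0 < ‖x‖ := norm_pos_iff.2 hx
    -- test on the tensor whose transform is a multiple of `x` in slice `p` and zero elsewhere
    let t : ℝ := (∏ k, α k) / ‖x‖
    let y : EuclideanSpace 𝕜 (Fin b) := (t : 𝕜) • x
    let W : Tensor 𝕜 b 1 d := Pi.single p (Matrix.of fun i _ => y i)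
    have hW : transform M (invTransform M W) = W :=
      transform_invTransform (isUnit_det_of_conjTranspose_mul_self hα hM) W
    have ht : ∀ {m : ℕ} (z : EuclideanSpace 𝕜 (Fin m)), ‖(t : 𝕜) • z‖ = t * ‖z‖ := fun z => by
      rw [norm_smul, RCLike.norm_ofReal, abs_of_nonneg (by positivity)]
    have single : ∀ {m : ℕ} (Z : Tensor 𝕜 m 1 d) (z : EuclideanSpace 𝕜 (Fin m)),
        (∀ i, Z p i 0 = z i) → (∀ q, q ≠ p → Z q = 0) → frobNorm Z = ‖z‖ := by
      intro m Z z h1 h2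
      rw [frobNorm_column, Finset.sum_eq_single p, Real.sqrt_sq (norm_nonneg _)]
      · congr 1
        ext i
        exact h1 i
      · intro q _ hq
        rw [h2 q hq, sq_eq_zero_iff, norm_eq_zero]
        rfl
      · simp
    have hV : frobNorm (invTransform M W) = 1 := by
      have h1 := frobNorm_transform hα hM (invTransform M W)
      rw [hW, single W y (fun i => by simp [W]) (fun q hq => by simp [W, hq]), ht] at h1
      have h2 : t * ‖x‖ = ∏ k, α k := div_mul_cancel₀ _ hx'.ne'
      rw [h2] at h1
      exact mul_left_cancel₀ hpos.ne' (by rw [← h1, mul_one])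
    have h1 := (le_csSup (bddAbove_frobNorm_lProd hα hM A) ⟨_, hV, rfl⟩).trans h
    have h2 := mul_frobNorm_lProd hα hM A (invTransform M W)
    rw [hW, single (fun q => transform M A q * W q) (toEuclideanLin (transform M A p) y)
      (fun i => by
        simp [W, Matrix.mul_apply, Matrix.toLpLin_apply, Matrix.mulVec, dotProduct])
      (fun q hq => by simp [W, hq]), map_smul, ht] at h2
    have h3 : t * ‖toEuclideanLin (transform M A p) x‖ ≤ t * ‖x‖ := by
      rw [← h2, div_mul_cancel₀ _ hx'.ne']
      exact mul_le_of_le_one_right hpos.le h1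
    exact le_of_mul_le_mul_left h3 (by positivity)
  · refine Real.sSup_le ?_ zero_le_one
    rintro r ⟨V, hV, rfl⟩
    have := frobNorm_lProd_le hα hM zero_le_one (fun p x => by simpa using h p x) V
    rwa [hV, mul_one] at this

theorem convex_spectralBall (hα : ∀ k, 0 < α k)
    (hM : ∀ k, (M k)ᴴ * M k = ((α k ^ 2 : ℝ) : 𝕜) • 1) : Convex ℝ (spectralBall a b M) := by
  intro A hA B hB s t hs ht hst
  rw [mem_spectralBall_iff hα hM] at hA hB ⊢
  intro p
  rw [transform_add, transform_smul, transform_smul]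
  exact (hA p).convex_combination (hB p) hs ht hst

/-! ### The nuclear norm -/

theorem norm_dot_transform (hM : ∀ k, (M k)ᴴ * M k = ((α k ^ 2 : ℝ) : 𝕜) • 1)
    (A B : Tensor 𝕜 a b d) :
    ‖dot (transform M A) (transform M B)‖ = (∏ k, α k) ^ 2 * ‖dot A B‖ := by
  rw [dot_transform hM, norm_mul, RCLike.norm_ofReal, abs_of_nonneg (sq_nonneg _)]

/-- The supremum that defines the nuclear norm is finite. -/
theorem bddAbove_norm_dot (hα : ∀ k, 0 < α k)
    (hM : ∀ k, (M k)ᴴ * M k = ((α k ^ 2 : ℝ) : 𝕜) • 1) (A : Tensor 𝕜 a b d) :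
    BddAbove {r : ℝ | ∃ B : Tensor 𝕜 a b d, spectralNorm M B ≤ 1 ∧ r = ‖dot A B‖} := by
  have hpos : 0 < ∏ k, α k := Finset.prod_pos fun k _ => hα k
  refine ⟨(∑ p, ∑ j, ‖toEuclideanLin (transform M A p) (EuclideanSpace.basisFun _ 𝕜 j)‖) /
    (∏ k, α k) ^ 2, ?_⟩
  rintro r ⟨B, hB, rfl⟩
  rw [le_div_iff₀' (by positivity), ← norm_dot_transform hM]
  exact (norm_sum_le _ _).trans (Finset.sum_le_sum fun p _ =>
    Matrix.norm_sum_mul_star_le _ ((mem_spectralBall_iff hα hM).1 hB p) _)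

theorem norm_dot_le_nuclearNorm (hα : ∀ k, 0 < α k)
    (hM : ∀ k, (M k)ᴴ * M k = ((α k ^ 2 : ℝ) : 𝕜) • 1) (A : Tensor 𝕜 a b d) {B : Tensor 𝕜 a b d}
    (hB : B ∈ spectralBall a b M) : ‖dot A B‖ ≤ nuclearNorm M A :=
  le_csSup (bddAbove_norm_dot hα hM A) ⟨B, hB, rfl⟩

theorem nuclearNorm_le {A : Tensor 𝕜 a b d} {t : ℝ} (ht : 0 ≤ t)
    (h : ∀ B ∈ spectralBall a b M, ‖dot A B‖ ≤ t) : nuclearNorm M A ≤ t := by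
  refine Real.sSup_le ?_ ht
  rintro r ⟨B, hB, rfl⟩
  exact h B hB

theorem nuclearNorm_nonneg (A : Tensor 𝕜 a b d) : 0 ≤ nuclearNorm M A := by
  refine Real.sSup_nonneg ?_
  rintro r ⟨B, -, rfl⟩
  exact norm_nonneg _

theorem dot_combination (s t : ℝ) (A B C : Tensor 𝕜 a b d) :
    dot (s • A + t • B) C = (s : 𝕜) * dot A C + (t : 𝕜) * dot B C := by
  simp only [dot, Finset.mul_sum, ← Finset.sum_add_distrib]
  refine Finset.sum_congr rfl fun p _ => Finset.sum_congr rfl fun i _ =>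
    Finset.sum_congr rfl fun j _ => ?_
  simp only [Pi.add_apply, Pi.smul_apply, Matrix.add_apply, Matrix.smul_apply,
    RCLike.real_smul_eq_coe_mul]
  ring

theorem convexOn_nuclearNorm (hα : ∀ k, 0 < α k)
    (hM : ∀ k, (M k)ᴴ * M k = ((α k ^ 2 : ℝ) : 𝕜) • 1) :
    ConvexOn ℝ (spectralBall a b M) (nuclearNorm M) := by
  refine ⟨convex_spectralBall hα hM, fun A _ B _ s t hs ht _ => ?_⟩
  refine nuclearNorm_le (add_nonneg (mul_nonneg hs (nuclearNorm_nonneg A))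
    (mul_nonneg ht (nuclearNorm_nonneg B))) fun C hC => ?_
  rw [dot_combination]
  refine (norm_add_le _ _).trans ?_
  rw [norm_mul, norm_mul, RCLike.norm_ofReal, RCLike.norm_ofReal, abs_of_nonneg hs,
    abs_of_nonneg ht]
  exact add_le_add (mul_le_mul_of_nonneg_left (norm_dot_le_nuclearNorm hα hM A hC) hs)
    (mul_le_mul_of_nonneg_left (norm_dot_le_nuclearNorm hα hM B hC) ht)

theorem mul_nuclearNorm_le_averageRank (hα : ∀ k, 0 < α k)
    (hM : ∀ k, (M k)ᴴ * M k = ((α k ^ 2 : ℝ) : 𝕜) • 1) {A : Tensor 𝕜 a b d}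
    (hA : A ∈ spectralBall a b M) :
    (∏ k, α k) ^ 2 / (numSlices d : ℝ) * nuclearNorm M A ≤ averageRank M A := by
  have hpos : 0 < ∏ k, α k := Finset.prod_pos fun k _ => hα k
  rw [averageRank, div_mul_eq_mul_div]
  refine div_le_div_of_nonneg_right ?_ (Nat.cast_nonneg _)
  rw [← le_div_iff₀' (by positivity)]
  refine nuclearNorm_le (by positivity) fun B hB => ?_
  rw [le_div_iff₀' (by positivity), ← norm_dot_transform hM]
  exact (norm_sum_le _ _).trans (Finset.sum_le_sum fun p _ =>
    Matrix.norm_sum_mul_star_le_rank ((mem_spectralBall_iff hα hM).1 hA p)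
      ((mem_spectralBall_iff hα hM).1 hB p))

theorem exists_mem_spectralBall_nuclearNorm_pos (ha : 0 < a) (hb : 0 < b) (hd : ∀ k, 0 < d k)
    (hα : ∀ k, 0 < α k) (hM : ∀ k, (M k)ᴴ * M k = ((α k ^ 2 : ℝ) : 𝕜) • 1) :
    ∃ A ∈ spectralBall a b M, 0 < nuclearNorm M A := by
  have : Nonempty (Fin a) := ⟨⟨0, ha⟩⟩
  have : Nonempty (Fin b) := ⟨⟨0, hb⟩⟩
  obtain ⟨X, hX0, hX⟩ := Matrix.exists_ne_zero_isContraction (𝕜 := 𝕜) (m := Fin a) (n := Fin b)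
  have hU := isUnit_det_of_conjTranspose_mul_self hα hM
  let A : Tensor 𝕜 a b d := invTransform M fun _ => X
  have hA : transform M A = fun _ => X := transform_invTransform hU _
  have hmem : A ∈ spectralBall a b M := by
    rw [mem_spectralBall_iff hα hM, hA]
    exact fun _ => hX
  refine ⟨A, hmem, lt_of_lt_of_le ?_ (norm_dot_le_nuclearNorm hα hM A hmem)⟩
  rw [norm_pos_iff, dot_self]
  intro h
  have h1 : frobNorm A = 0 := by simpa using h
  have h2 := frobNorm_transform hα hM A
  rw [h1, mul_zero, hA, frobNorm, Real.sqrt_eq_zero (by positivity)] at h2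
  refine hX0 ?_
  ext i j
  have h3 := (Finset.sum_eq_zero_iff_of_nonneg (fun p _ => by positivity)).1 h2
    (fun k => ⟨0, hd k⟩) (Finset.mem_univ _)
  have h4 := (Finset.sum_eq_zero_iff_of_nonneg (fun p _ => by positivity)).1 h3 i
    (Finset.mem_univ _)
  have h5 := (Finset.sum_eq_zero_iff_of_nonneg (fun p _ => by positivity)).1 h4 j
    (Finset.mem_univ _)
  simpa using h5

/-! ### The convex envelope -/

/-- A convex function on the cube `[0, 1]^ι` that is bounded at the vertices by a multiple of the
number of ones is bounded on the cube by the same multiple of the sum of the coordinates. -/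
theorem _root_.ConvexOn.le_sum_of_le_card {ι : Type*} [Fintype ι] {F : (ι → ℝ) → ℝ} {t : ℝ}
    (hF : ConvexOn ℝ (Set.univ.pi fun _ => Set.Icc (0 : ℝ) 1) F)
    (h : ∀ e : ι → ℝ, (∀ i, e i = 0 ∨ e i = 1) → F e ≤ t * ∑ i, e i) {x : ι → ℝ}
    (hx : ∀ i, x i ∈ Set.Icc (0 : ℝ) 1) : F x ≤ t * ∑ i, x i := by
  let l : (ι → ℝ) →ₗ[ℝ] ℝ := t • ∑ i, LinearMap.proj i
  have hl : ∀ y, l y = t * ∑ i, y i := fun y => by simp [l]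
  have hconv : ConvexOn ℝ (Set.univ.pi fun _ => Set.Icc (0 : ℝ) 1) fun y => F y - l y :=
    hF.sub (l.concaveOn hF.1)
  have hmem : x ∈ convexHull ℝ (Set.univ.pi fun _ : ι => ({0, 1} : Set ℝ)) := by
    rw [convexHull_pi]
    intro i _
    rw [convexHull_pair, segment_eq_Icc zero_le_one]
    exact hx i
  obtain ⟨e, he, hle⟩ := hconv.exists_ge_of_mem_convexHull (fun e he i hi => by
    rcases he i hi with h0 | h0 <;> simp_all) hmem
  have h1 := h e fun i => he i (Set.mem_univ i)
  simp only [hl] at hle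
  linarith

/-- Every convex minorant of the average rank on the spectral ball lies below the normalized
nuclear norm. With singular value decompositions of all slices of the transform of `A`, the
singular values being replaced by arbitrary numbers in `[0, 1]`, the cube of these numbers is
mapped linearly to the spectral ball. At its vertices the average rank is at most the mean number
of ones; hence at `A` the minorant is at most the normalized sum of the singular values, which is
the inner product of `A` with the image of the all-ones vertex, up to normalization. -/
theorem le_mul_nuclearNorm_of_convexOn (hα : ∀ k, 0 < α k)
    (hM : ∀ k, (M k)ᴴ * M k = ((α k ^ 2 : ℝ) : 𝕜) • 1) {h : Tensor 𝕜 a b d → ℝ}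
    (hconv : ConvexOn ℝ (spectralBall a b M) h)
    (hle : ∀ A ∈ spectralBall a b M, h A ≤ averageRank M A) {A : Tensor 𝕜 a b d}
    (hA : A ∈ spectralBall a b M) :
    h A ≤ (∏ k, α k) ^ 2 / (numSlices d : ℝ) * nuclearNorm M A := by
  have hU := isUnit_det_of_conjTranspose_mul_self hα hM
  choose u v σ hσ hX hc hdot using fun p =>
    ((mem_spectralBall_iff hα hM).1 hA p).exists_singularValues
  let ψ : ((((k : Fin n) → Fin (d k)) × Fin b) → ℝ) →ₗ[ℝ] Tensor 𝕜 a b d :=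
    { toFun := fun c p => ofSingular (u p) (v p) fun i => c (p, i)
      map_add' := fun c e => funext fun p => Matrix.ofSingular_add _ _ _ _
      map_smul' := fun t c => funext fun p => Matrix.ofSingular_smul _ _ _ _ }
  let φ := (transformEquiv a b M hU).symm.toLinearMap ∘ₗ ψ
  have hφ : ∀ c, transform M (φ c) = ψ c := fun c => transform_invTransform hU _
  have hball : ∀ c, (∀ i, c i ∈ Set.Icc (0 : ℝ) 1) → φ c ∈ spectralBall a b M := fun c h01 => by
    rw [mem_spectralBall_iff hα hM, hφ]
    exact fun p => hc p _ fun i => h01 (p, i)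
  have hφA : φ (fun x => σ x.1 x.2) = A := by
    have h1 : ψ (fun x => σ x.1 x.2) = transform M A := funext hX
    have h2 : φ (fun x => σ x.1 x.2) = invTransform M (ψ fun x => σ x.1 x.2) := rfl
    rw [h2, h1, invTransform_transform hU]
  have hcube : ConvexOn ℝ (Set.univ.pi fun _ => Set.Icc (0 : ℝ) 1) (h ∘ φ) :=
    (hconv.comp_linearMap φ).subset (fun c h01 => hball c fun i => h01 i (Set.mem_univ i))
      (convex_pi fun _ _ => convex_Icc _ _)
  have key := hcube.le_sum_of_le_card (t := 1 / (numSlices d : ℝ)) (fun e he => ?_)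
    (x := fun x => σ x.1 x.2) fun x => hσ x.1 x.2
  · rw [Function.comp_apply, hφA] at key
    refine key.trans ?_
    rw [one_div_mul_eq_div, div_mul_eq_mul_div]
    refine div_le_div_of_nonneg_right ?_ (Nat.cast_nonneg _)
    have hone : φ 1 ∈ spectralBall a b M := hball 1 fun i => by simp
    refine le_trans ?_
      (mul_le_mul_of_nonneg_left (norm_dot_le_nuclearNorm hα hM A hone) (sq_nonneg _))
    rw [← norm_dot_transform hM, hφ]
    have h1 : dot (transform M A) (ψ 1) =
        ((∑ x : ((k : Fin n) → Fin (d k)) × Fin b, σ x.1 x.2 : ℝ) : 𝕜) := by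
      rw [Fintype.sum_prod_type, RCLike.ofReal_sum]
      exact Finset.sum_congr rfl fun p _ => hdot p
    rw [h1, RCLike.norm_ofReal]
    exact le_abs_self _
  · refine (hle _ (hball e fun i => ?_)).trans ?_
    · rcases he i with h0 | h0 <;> simp [h0]
    · rw [averageRank, one_div_mul_eq_div, hφ]
      refine div_le_div_of_nonneg_right ?_ (Nat.cast_nonneg _)
      rw [Fintype.sum_prod_type]
      refine Finset.sum_le_sum fun p _ => ?_
      calc ((ψ e p).rank : ℝ) ≤ (Fintype.card {i // e (p, i) ≠ 0} : ℝ) := by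
            exact_mod_cast Matrix.rank_ofSingular_le (u p) (v p) fun i => e (p, i)
        _ = ∑ i, if e (p, i) ≠ 0 then (1 : ℝ) else 0 := by
            rw [Fintype.card_subtype, Finset.sum_boole]
        _ = ∑ i, e (p, i) := Finset.sum_congr rfl fun i _ => by
            rcases he (p, i) with h0 | h0 <;> simp [h0]

end Tensor

theorem IsConvexEnvelopeOn.eqOn {E : Type*} [AddCommGroup E] [Module ℝ E] {S : Set E}
    {f g g' : E → ℝ} (h : IsConvexEnvelopeOn S f g) (h' : IsConvexEnvelopeOn S f g') :
    Set.EqOn g g' S := fun x hx =>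
  le_antisymm (h'.2.2 g h.1 h.2.1 x hx) (h.2.2 g' h'.1 h'.2.1 x hx)

theorem mainTheorem4 {𝕜 : Type*} [RCLike 𝕜] {n : ℕ} (a b : ℕ) (d : Fin n → ℕ)
    (ha : 0 < a) (hb : 0 < b) (hd : ∀ k, 0 < d k)
    (α : Fin n → ℝ) (hα : ∀ k, 0 < α k)
    (R : (k : Fin n) → Matrix (Fin (d k)) (Fin (d k)) 𝕜)
    (hR : ∀ k, R k ∈ Matrix.unitaryGroup (Fin (d k)) 𝕜)
    (M : (k : Fin n) → Matrix (Fin (d k)) (Fin (d k)) 𝕜)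
    (hM : ∀ k, M k = ((α k : ℝ) : 𝕜) • R k) :
    IsConvexEnvelopeOn (Tensor.spectralBall a b M) (Tensor.averageRank M)
        (fun A => (∏ k, α k) ^ 2 / (Tensor.numSlices d : ℝ) * Tensor.nuclearNorm M A) ∧
      (IsConvexEnvelopeOn (Tensor.spectralBall a b M) (Tensor.averageRank M)
          (Tensor.nuclearNorm M) ↔
        (∏ k, α k) ^ 2 = (Tensor.numSlices d : ℝ)) := by
  have hM' : ∀ k, (M k).conjTranspose * M k = ((α k ^ 2 : ℝ) : 𝕜) • 1 := fun k => by
    have h : (R k).conjTranspose * R k = 1 := (Matrix.mem_unitaryGroup_iff').1 (hR k)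
    rw [hM, Matrix.conjTranspose_smul, Matrix.smul_mul, Matrix.mul_smul, h, smul_smul,
      RCLike.star_def, RCLike.conj_ofReal, ← RCLike.ofReal_mul, sq]
  have hP : (0 : ℝ) < (Tensor.numSlices d : ℝ) :=
    Nat.cast_pos.2 (Finset.prod_pos fun k _ => hd k)
  have henv : IsConvexEnvelopeOn (Tensor.spectralBall a b M) (Tensor.averageRank M)
      (fun A => (∏ k, α k) ^ 2 / (Tensor.numSlices d : ℝ) * Tensor.nuclearNorm M A) :=
    ⟨(Tensor.convexOn_nuclearNorm hα hM').smul (div_nonneg (sq_nonneg _) hP.le),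
      fun A hA => Tensor.mul_nuclearNorm_le_averageRank hα hM' hA,
      fun h hconv hle A hA => Tensor.le_mul_nuclearNorm_of_convexOn hα hM' hconv hle hA⟩
  refine ⟨henv, fun h => ?_, fun h => ?_⟩
  · obtain ⟨A, hA, hpos⟩ :=
      Tensor.exists_mem_spectralBall_nuclearNorm_pos ha hb hd hα hM'
    have h1 := henv.eqOn h hA
    exact (div_eq_one_iff_eq hP.ne').1 (mul_right_cancel₀ hpos.ne' (h1.trans (one_mul _).symm))
  · simpa only [h, div_self hP.ne', one_mul] using henv
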